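/- Let $A_1,\dots,A_d\in\mathbb R^{n\times n}$ be pairwise commuting symmetric matrices. Call $\Lambda=(\lambda^{(1)},\dots,\lambda^{(d)})^T\in\mathbb R^d$ an eigenvalue vector of the family if there is $x\neq 0$ with $A_kx=\lambda^{(k)}x$ for $k=1,\dots,d$. Let $\Lambda_1,\dots,\Lambda_m$ be the mutually distinct eigenvalue vectors and $\mathsf{gap}:=\min_{i\ne j}\|\Lambda_i-\Lambda_j\|_2>0$. Let $\epsilon>0$ and let $E_1,\dots,E_d\in\mathbb R^{n\times n}$ be symmetric with $(\|E_1\|_F^2+\cdots+\|E_d\|_F^2)^{1/2}\le\epsilon$. Put $\tilde A_k:=A_k+E_k$. Let $\tilde Q$ be the output of randomized joint diagonalization (RJD) with one trial applied to $\tilde A_1,\dots,\tilde A_d$; that is, a standard Gaussian vector $\mu\sim\mathcal N(0,I_d)$ is drawn, and $\tilde Q$ is an orthogonal $n\times n$ matrix, chosen in any way, such that $\tilde Q^T(\mu_1\tilde A_1+\cdots+\mu_d\tilde A_d)\tilde Q$ is diagonal. Then for every $R>1$, \[ \mathbb P\Big(\Big(\sum_{k=1}^d\big\|\mathrm{offdiag}(\tilde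 Q^T\tilde A_k\tilde Q)\big\|_F^2\Big)^{1/2}\le R\epsilon\Big)\ \ge\ 1-\sqrt{\frac{d}{2\pi}}\;m(m-1)\,\gamma,\qquad \gamma=\max\Big\{\frac{\sqrt{5d}}{R-1},\ \frac{4\epsilon}{\mathsf{gap}}\Big\}, \] where $\|\cdot\|_F$ is the Frobenius norm and $\mathrm{offdiag}$ sets the diagonal entries of a matrix to zero and preserves the others. (If $m\le 1$, there is no gap and the right-hand side is read as $1$.) -/

import Mathlib

open MeasureTheory ProbabilityTheory
open scoped Matrix

attribute [local instance] Matrix.frobeniusNormedAddCommGroup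

namespace RJD

/-- `offDiag M` sets the diagonal entries of `M` to zero and preserves the others. -/
def offDiag {n : ℕ} (M : Matrix (Fin n) (Fin n) ℝ) : Matrix (Fin n) (Fin n) ℝ :=
  Matrix.of fun i j => if i = j then 0 else M i j

/-- The random linear combination `B(μ) = μ₁ B₁ + ⋯ + μ_d B_d`. -/
noncomputable def linComb {n d : ℕ} (B : Fin d → Matrix (Fin n) (Fin n) ℝ)
    (μ : EuclideanSpace ℝ (Fin d)) : Matrix (Fin n) (Fin n) ℝ :=
  ∑ k, μ k • B k

/-- The measure of off-diagonality `∑ₖ ‖offDiag (Qᵀ Bₖ Q)‖²` (Frobenius norm). -/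
noncomputable def loss {n d : ℕ} (B : Fin d → Matrix (Fin n) (Fin n) ℝ)
    (Q : Matrix (Fin n) (Fin n) ℝ) : ℝ :=
  ∑ k, ‖offDiag (Qᵀ * B k * Q)‖ ^ 2

/-- `Q` is an orthogonal matrix and `Qᵀ M Q` is diagonal. -/
def Diagonalizes {n : ℕ} (Q M : Matrix (Fin n) (Fin n) ℝ) : Prop :=
  Q ∈ Matrix.orthogonalGroup (Fin n) ℝ ∧ (Qᵀ * M * Q).IsDiag

/-- `Q` is an admissible output of randomized joint diagonalization with `L` trials on the
family `B` when the vectors drawn are `μ 0, …, μ (L - 1)`: for each trial an orthogonal matrix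
diagonalizing `B(μ i)` is computed (no assumption is made on which one), and a trial with the
smallest off-diagonality is returned. -/
def IsOutput {n d L : ℕ} (B : Fin d → Matrix (Fin n) (Fin n) ℝ)
    (μ : Fin L → EuclideanSpace ℝ (Fin d)) (Q : Matrix (Fin n) (Fin n) ℝ) : Prop :=
  ∃ T : Fin L → Matrix (Fin n) (Fin n) ℝ,
    (∀ i, Diagonalizes (T i) (linComb B (μ i))) ∧
      ∃ i₀, (∀ i, loss B (T i₀) ≤ loss B (T i)) ∧ Q = T i₀

/-- `Q` is the (random) output of a run of randomized joint diagonalization with `L` trials on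
the family `B`; `μ` are the vectors drawn, which are independent standard Gaussian vectors
in `ℝᵈ`. The eigenvalue solver is arbitrary, and may itself use further randomness. -/
structure IsRun {Ω : Type*} [MeasurableSpace Ω] (P : Measure Ω) {n d : ℕ} (L : ℕ)
    (B : Fin d → Matrix (Fin n) (Fin n) ℝ) (μ : Ω → Fin L → EuclideanSpace ℝ (Fin d))
    (Q : Ω → Matrix (Fin n) (Fin n) ℝ) : Prop where
  law : HasLaw μ (Measure.pi fun _ : Fin L => stdGaussian (EuclideanSpace ℝ (Fin d))) P
  output : ∀ᵐ ω ∂P, IsOutput B (μ ω) (Q ω)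

/-- The set of eigenvalue vectors of the family `A`: the vectors `Λ ∈ ℝᵈ` collecting the
eigenvalues `Aₖ x = Λₖ x` of a common eigenvector `x ≠ 0`. -/
def eigenvalueVectors {n d : ℕ} (A : Fin d → Matrix (Fin n) (Fin n) ℝ) :
    Set (EuclideanSpace ℝ (Fin d)) :=
  {Λ | ∃ x : Fin n → ℝ, x ≠ 0 ∧ ∀ k, A k *ᵥ x = Λ k • x}

/-- The number `m` of mutually distinct eigenvalue vectors. -/
noncomputable def numEigenvalueVectors {n d : ℕ} (A : Fin d → Matrix (Fin n) (Fin n) ℝ) : ℕ :=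
  (eigenvalueVectors A).ncard

/-- The smallest Euclidean distance of two distinct eigenvalue vectors. -/
noncomputable def gap {n d : ℕ} (A : Fin d → Matrix (Fin n) (Fin n) ℝ) : ℝ :=
  sInf {r | ∃ Λ ∈ eigenvalueVectors A, ∃ Λ' ∈ eigenvalueVectors A, Λ ≠ Λ' ∧ r = ‖Λ - Λ'‖}

/-- There are finitely many eigenvalue vectors, so `ncard` really counts them. -/
theorem finite_eigenvalueVectors {n d : ℕ} (A : Fin d → Matrix (Fin n) (Fin n) ℝ) :
    (eigenvalueVectors A).Finite := by
  have h : (Set.univ.pi fun k : Fin d =>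
      {c : ℝ | Module.End.HasEigenvalue (Matrix.toLin' (A k)) c}).Finite :=
    Set.Finite.pi fun k => Module.End.finite_hasEigenvalue _
  refine Set.Finite.of_finite_image (f := fun Λ : EuclideanSpace ℝ (Fin d) => Λ.ofLp)
    (h.subset ?_) (WithLp.ofLp_injective 2).injOn
  rintro _ ⟨Λ, ⟨x, hx, hA⟩, rfl⟩ k -
  refine Module.End.hasEigenvalue_of_hasEigenvector (x := x) ⟨?_, hx⟩
  rw [Module.End.mem_eigenspace_iff, Matrix.toLin'_apply, hA k]

/-- If there are at least two eigenvalue vectors, the minimum that defines `gap` is attained,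
and it is positive. -/
theorem gap_isLeast {n d : ℕ} (A : Fin d → Matrix (Fin n) (Fin n) ℝ)
    (hm : 2 ≤ numEigenvalueVectors A) :
    IsLeast {r | ∃ Λ ∈ eigenvalueVectors A, ∃ Λ' ∈ eigenvalueVectors A,
      Λ ≠ Λ' ∧ r = ‖Λ - Λ'‖} (gap A) ∧ 0 < gap A := by
  set S := {r | ∃ Λ ∈ eigenvalueVectors A, ∃ Λ' ∈ eigenvalueVectors A,
      Λ ≠ Λ' ∧ r = ‖Λ - Λ'‖} with hS
  have hfin : S.Finite := by
    refine (((finite_eigenvalueVectors A).prod (finite_eigenvalueVectors A)).image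
      fun p => ‖p.1 - p.2‖).subset ?_
    rintro r ⟨Λ, h, Λ', h', -, rfl⟩
    exact ⟨(Λ, Λ'), ⟨h, h'⟩, rfl⟩
  have hne : S.Nonempty := by
    obtain ⟨a, b, ha, hb, hab⟩ := (Set.one_lt_ncard_iff (finite_eigenvalueVectors A)).1 hm
    exact ⟨_, a, ha, b, hb, hab, rfl⟩
  have hmem : gap A ∈ S := hne.csInf_mem hfin
  refine ⟨⟨hmem, fun r hr => csInf_le hfin.bddBelow hr⟩, ?_⟩
  obtain ⟨Λ, -, Λ', -, hne', h⟩ := hmem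
  rw [h]
  exact norm_pos_iff.2 (sub_ne_zero.2 hne')

end RJD

namespace RJD

open scoped RealInnerProductSpace

/-! The randomness is used only to keep `μ` away from the hyperplanes orthogonal to differences of
eigenvalue vectors; the rest is deterministic perturbation theory.

Let `V` diagonalize the unperturbed family, put `W = Vᵀ * Q`, and let `α p`, `δ i` be the
eigenvalues of the unperturbed and perturbed combinations. Then `Vᵀ * linComb E μ * Q` has entries
`W p i * (δ i - α p)` and Frobenius norm at most `ε * ‖μ‖`. Each `δ i` is therefore within `ε * ‖μ‖`
of some `α (c i)`. If `μ` is well separated from all those hyperplanes, `|δ i - α p|` dominates `γ /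
2 * ‖μ‖ * ‖Λ p - Λ (c i)‖`, so the same entries control how far `Q` is from diagonalizing every `A
k`: this is `loss_le_of_separated`, with bound `2 * ε / γ`. Restoring the `E k` costs another `ε`,
and `2 / γ + 1 ≤ R`.

For one difference, separation fails with probability at most `√(2d/π) * γ`
(`stdGaussian_real_abs_inner_le`): given the other coordinates, the component of `μ` along the
difference has bounded density. A union bound over `m(m-1)/2` pairs finishes. -/

/-! ### Gaussian anti-concentration -/

/-- Anti-concentration of a standard Gaussian variable around its mean. -/
lemma gaussianReal_abs_le_le (s : ℝ) :
    gaussianReal 0 1 {x | |x| ≤ s} ≤ ENNReal.ofReal (√(2 / Real.pi) * s) := by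
  rw [gaussianReal_apply 0 one_ne_zero]
  have hset : {x : ℝ | |x| ≤ s} = Set.Icc (-s) s := by
    ext x; simp [abs_le]
  have hc : √(2 / Real.pi) * s = (√(2 * Real.pi))⁻¹ * (s - -s) := by
    have h : √(2 / Real.pi) = 2 * (√(2 * Real.pi))⁻¹ := by
      rw [Real.sqrt_eq_iff_mul_self_eq (by positivity) (by positivity)]
      have := Real.mul_self_sqrt (show 0 ≤ 2 * Real.pi by positivity)
      field_simp
      nlinarith
    rw [h]; ring
  calc ∫⁻ x in {x : ℝ | |x| ≤ s}, gaussianPDF 0 1 x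
      ≤ ∫⁻ _ in {x : ℝ | |x| ≤ s}, ENNReal.ofReal (√(2 * Real.pi))⁻¹ := by
        refine lintegral_mono fun x => ENNReal.ofReal_le_ofReal ?_
        rw [gaussianPDFReal]
        simp only [NNReal.coe_one, mul_one]
        refine mul_le_of_le_one_right (by positivity) (Real.exp_le_one_iff.2 ?_)
        rw [neg_div]
        exact neg_nonpos.2 (by positivity)
    _ = ENNReal.ofReal (√(2 / Real.pi) * s) := by
        rw [setLIntegral_const, hset, Real.volume_Icc, hc, ENNReal.ofReal_mul (by positivity)]

/-- The expected norm of a standard Gaussian vector in `ℝᵏ` is at most `√k`. -/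
lemma lintegral_sqrt_sum_sq_le (k : ℕ) (a : ℝ) (ha : 0 ≤ a) :
    ∫⁻ y : Fin k → ℝ, ENNReal.ofReal (a * √(∑ i, y i ^ 2))
        ∂(Measure.pi fun _ => gaussianReal 0 1) ≤ ENNReal.ofReal (a * √k) := by
  rcases Nat.eq_zero_or_pos k with rfl | hk
  · simp
  have hk' : (0 : ℝ) < √k := by positivity
  have hsq : (√k : ℝ) ^ 2 = k := Real.sq_sqrt (by positivity)
  have hint1 : Integrable (fun x : ℝ => x ^ 2) (gaussianReal 0 1) :=
    IsGaussian.memLp_two_id.integrable_sq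
  have hI (i : Fin k) : Integrable (fun y : Fin k → ℝ => y i ^ 2)
      (Measure.pi fun _ => gaussianReal 0 1) :=
    integrable_comp_eval (μ := fun _ : Fin k => gaussianReal 0 1) (i := i)
      (f := fun x : ℝ => x ^ 2) hint1
  have hE (i : Fin k) : ∫ y : Fin k → ℝ, y i ^ 2 ∂(Measure.pi fun _ => gaussianReal 0 1) = 1 := by
    rw [integral_comp_eval (μ := fun _ : Fin k => gaussianReal 0 1) (i := i)
      (f := fun x : ℝ => x ^ 2) hint1.aestronglyMeasurable]
    have h := variance_id_gaussianReal (μ := 0) (v := 1)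
    rw [variance_eq_integral (by fun_prop)] at h
    simpa using h
  have hint : Integrable (fun y : Fin k → ℝ => a * ((∑ i, y i ^ 2) / (2 * √k) + √k / 2))
      (Measure.pi fun _ => gaussianReal 0 1) :=
    (((integrable_finsetSum _ fun i _ => hI i).div_const _).add (integrable_const _)).const_mul _
  calc _ ≤ ∫⁻ y : Fin k → ℝ, ENNReal.ofReal (a * ((∑ i, y i ^ 2) / (2 * √k) + √k / 2))
          ∂(Measure.pi fun _ => gaussianReal 0 1) := by
        refine lintegral_mono fun y => ENNReal.ofReal_le_ofReal ?_
        refine mul_le_mul_of_nonneg_left ?_ ha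
        have h0 : 0 ≤ ∑ i, y i ^ 2 := by positivity
        have h1 := Real.sq_sqrt h0
        -- AM-GM, with equality when the sum of squares equals its mean `k`; this plays the role of
        -- Jensen's inequality.
        have : (∑ i, y i ^ 2) / (2 * √k) + √k / 2 - √(∑ i, y i ^ 2)
            = (√(∑ i, y i ^ 2) - √k) ^ 2 / (2 * √k) := by
          field_simp
          nlinarith
        have h2 : 0 ≤ (√(∑ i, y i ^ 2) - √k) ^ 2 / (2 * √k) := by positivity
        linarith
    _ = ENNReal.ofReal (a * √k) := by
        rw [← ofReal_integral_eq_lintegral_ofReal hint (ae_of_all _ fun y => by positivity)]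
        congr 1
        rw [integral_const_mul, integral_add
          ((integrable_finsetSum _ fun i _ => hI i).div_const _) (integrable_const _),
          integral_div, integral_finsetSum _ fun i _ => hI i]
        simp only [hE, Finset.sum_const, Finset.card_univ, Fintype.card_fin, nsmul_eq_mul, mul_one,
          integral_const, probReal_univ, smul_eq_mul, one_mul]
        congr 1
        field_simp
        nlinarith

/-- A standard Gaussian vector in `ℝᵏ⁺¹` is nearly orthogonal to a fixed coordinate axis with
small probability. -/
lemma pi_gaussianReal_abs_zero_le (k : ℕ) (c : ℝ) (hc : 0 ≤ c) :
    (Measure.pi fun _ : Fin (k + 1) => gaussianReal 0 1)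
        {x | |x 0| ≤ c * √(∑ i : Fin k, x i.succ ^ 2)} ≤
      ENNReal.ofReal (√(2 / Real.pi) * c * √k) := by
  have hmp := measurePreserving_piFinSuccAbove (fun _ : Fin (k + 1) => gaussianReal 0 1) 0
  set B : Set (ℝ × (Fin k → ℝ)) := {z | |z.1| ≤ c * √(∑ i : Fin k, z.2 i ^ 2)} with hB
  have hBm : MeasurableSet B := measurableSet_le (by fun_prop) (by fun_prop)
  have hpre : {x : Fin (k + 1) → ℝ | |x 0| ≤ c * √(∑ i : Fin k, x i.succ ^ 2)} =
      MeasurableEquiv.piFinSuccAbove (fun _ => ℝ) 0 ⁻¹' B := by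
    ext x
    simp [hB, MeasurableEquiv.piFinSuccAbove, Fin.insertNthEquiv, Fin.tail]
  -- Fubini: with the last `k` coordinates frozen, the threshold for `x 0` is a constant.
  rw [hpre, hmp.measure_preimage hBm.nullMeasurableSet, Measure.prod_apply_symm hBm]
  calc _ ≤ ∫⁻ y : Fin k → ℝ, ENNReal.ofReal (√(2 / Real.pi) * c * √(∑ i, y i ^ 2))
          ∂(Measure.pi fun _ => gaussianReal 0 1) := by
        refine lintegral_mono fun y => ?_
        rw [mul_assoc]
        exact gaussianReal_abs_le_le _
    _ ≤ _ := lintegral_sqrt_sum_sq_le k _ (by positivity)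

/-- A standard Gaussian vector is nearly orthogonal to a fixed unit vector with small
probability. -/
lemma stdGaussian_abs_inner_le {E : Type*} [NormedAddCommGroup E] [InnerProductSpace ℝ E]
    [FiniteDimensional ℝ E] [MeasurableSpace E] [BorelSpace E] {k : ℕ}
    (hk : Module.finrank ℝ E = k + 1) (v : E) (hv : ‖v‖ = 1) (t : ℝ) (ht0 : 0 ≤ t) (ht1 : t < 1) :
    stdGaussian E {x | |⟪x, v⟫| ≤ t * ‖x‖} ≤
      ENNReal.ofReal (√(2 / Real.pi) * (t / √(1 - t ^ 2)) * √k) := by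
  have horth : Orthonormal ℝ (({0} : Set (Fin (k + 1))).domRestrict fun _ => v) :=
    ⟨fun _ => hv, fun i j hij => (hij (Subsingleton.elim _ _)).elim⟩
  obtain ⟨b, hb⟩ := horth.exists_orthonormalBasis_extension_of_card_eq (by simp [hk])
  have hb0 : b 0 = v := hb 0 rfl
  have ht2 : 0 < 1 - t ^ 2 := by nlinarith
  rw [stdGaussian_eq_map_pi_orthonormalBasis b, Measure.map_apply (by fun_prop)
    (measurableSet_le (by fun_prop) (by fun_prop))]
  refine (measure_mono ?_).trans (pi_gaussianReal_abs_zero_le k (t / √(1 - t ^ 2)) (by positivity))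
  intro x hx
  simp only [Set.preimage_ofPred_eq, Set.mem_ofPred_eq] at hx ⊢
  have h1 : ⟪∑ i, x i • b i, v⟫ = x 0 := by
    rw [← hb0, b.orthonormal.inner_left_fintype]; simp
  have h2 : ‖∑ i, x i • b i‖ ^ 2 = x 0 ^ 2 + ∑ i : Fin k, x i.succ ^ 2 := by
    rw [← Fin.sum_univ_succ (fun i => x i ^ 2), ← real_inner_self_eq_norm_sq,
      b.orthonormal.inner_sum]
    simp [sq]
  rw [h1] at hx
  -- Solving this for `x 0 ^ 2` produces the factor `t / √(1 - t ^ 2)`.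
  have h3 : x 0 ^ 2 ≤ t ^ 2 * (x 0 ^ 2 + ∑ i : Fin k, x i.succ ^ 2) := by
    rw [← h2, ← mul_pow, ← sq_abs]
    exact pow_le_pow_left₀ (abs_nonneg _) hx 2
  have h0 : 0 ≤ ∑ i : Fin k, x i.succ ^ 2 := by positivity
  refine abs_le_of_sq_le_sq ?_ (by positivity)
  rw [mul_pow, div_pow, Real.sq_sqrt ht2.le, Real.sq_sqrt h0, div_mul_eq_mul_div,
    le_div_iff₀ ht2]
  linarith

/-- The bound of `stdGaussian_abs_inner_le` in a form that is linear in the threshold and does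
not become void before it exceeds `1`. -/
lemma stdGaussian_real_abs_inner_le {d : ℕ} (hd : 1 ≤ d) (v : EuclideanSpace ℝ (Fin d))
    (hv : v ≠ 0) (γ : ℝ) (hγ : 0 ≤ γ) :
    (stdGaussian (EuclideanSpace ℝ (Fin d))).real {x | |⟪x, v⟫| ≤ 3 / 4 * γ * ‖x‖ * ‖v‖} ≤
      √(2 * d / Real.pi) * γ := by
  obtain ⟨k, rfl⟩ : ∃ k, d = k + 1 := ⟨d - 1, by omega⟩
  -- A bound of at least `1` is trivial. Otherwise `(k + 1) * γ ^ 2 < π / 2 < 8 / 5`, so `t = 3 / 4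
  -- * γ` satisfies `t ^ 2 ≤ 9 / 10`.
  rcases le_or_gt 1 (√(2 * (k + 1 : ℕ) / Real.pi) * γ) with h | h
  · exact measureReal_le_one.trans h
  have hk0 : (0 : ℝ) ≤ k := k.cast_nonneg
  have hπ := Real.pi_pos
  have h2 : (k + 1 : ℝ) * γ ^ 2 ≤ 8 / 5 := by
    have h3 : (√(2 * (k + 1 : ℕ) / Real.pi) * γ) ^ 2 < 1 :=
      pow_lt_one₀ (by positivity) h two_ne_zero
    rw [mul_pow, Real.sq_sqrt (by positivity), div_mul_eq_mul_div, div_lt_one hπ] at h3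
    have := Real.pi_lt_d2
    push_cast at h3
    linarith
  have hγ2 : γ ^ 2 ≤ 8 / 5 := le_trans (le_mul_of_one_le_left (sq_nonneg γ) (by linarith)) h2
  have ht : (3 / 4 * γ) ^ 2 < 1 := by nlinarith
  have ht1 : 3 / 4 * γ < 1 := by nlinarith
  have ht2 : 0 < 1 - (3 / 4 * γ) ^ 2 := by linarith
  have hv' : ‖v‖ ≠ 0 := norm_ne_zero_iff.2 hv
  have hset : {x : EuclideanSpace ℝ (Fin (k + 1)) | |⟪x, v⟫| ≤ 3 / 4 * γ * ‖x‖ * ‖v‖} =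
      {x | |⟪x, ‖v‖⁻¹ • v⟫| ≤ 3 / 4 * γ * ‖x‖} := by
    ext x
    simp only [Set.mem_ofPred_eq, inner_smul_right, abs_mul, abs_inv, abs_norm]
    rw [inv_mul_le_iff₀ (by positivity), mul_comm ‖v‖]
  have hb := stdGaussian_abs_inner_le (k := k) (by simp) (‖v‖⁻¹ • v)
    (by rw [norm_smul, norm_inv, norm_norm, inv_mul_cancel₀ hv']) (3 / 4 * γ) (by positivity) ht1
  rw [hset]
  refine (ENNReal.toReal_le_of_le_ofReal (by positivity) hb).trans ?_
  have hsplit : √(2 * ((k + 1 : ℕ) : ℝ) / Real.pi) = √(2 / Real.pi) * √(k + 1) := by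
    rw [← Real.sqrt_mul (by positivity)]; congr 1; push_cast; ring
  rw [hsplit, mul_assoc, mul_assoc]
  refine mul_le_mul_of_nonneg_left ?_ (by positivity)
  rw [div_mul_eq_mul_div, div_le_iff₀ (by positivity)]
  refine le_of_sq_le_sq ?_ (by positivity)
  rw [mul_pow, mul_pow (_ * _), mul_pow √_, Real.sq_sqrt hk0, Real.sq_sqrt ht2.le,
    Real.sq_sqrt (by positivity)]
  -- The second factor is at least `k + 1 - 9 / 10 - 9 / 16 * k`, which is positive.
  have : 0 ≤ γ ^ 2 * ((k + 1) * (1 - (3 / 4 * γ) ^ 2) - 9 / 16 * k) :=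
    mul_nonneg (sq_nonneg γ) (by nlinarith)
  nlinarith

/-! ### Deterministic perturbation bound -/

section Perturbation

variable {n d : ℕ}

lemma frobenius_norm_sq (M : Matrix (Fin n) (Fin n) ℝ) : ‖M‖ ^ 2 = ∑ i, ∑ j, M i j ^ 2 := by
  rw [Matrix.frobenius_norm_def, ← Real.sqrt_eq_rpow, Real.sq_sqrt (by positivity)]
  simp

lemma frobenius_norm_sq_eq_trace (M : Matrix (Fin n) (Fin n) ℝ) :
    ‖M‖ ^ 2 = (Mᵀ * M).trace := by
  rw [frobenius_norm_sq, Finset.sum_comm]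
  simp [Matrix.trace, Matrix.mul_apply, sq]

lemma frobenius_norm_mul_left {U : Matrix (Fin n) (Fin n) ℝ} (hU : Uᵀ * U = 1)
    (M : Matrix (Fin n) (Fin n) ℝ) : ‖U * M‖ = ‖M‖ := by
  refine (sq_eq_sq₀ (norm_nonneg _) (norm_nonneg _)).1 ?_
  rw [frobenius_norm_sq_eq_trace, frobenius_norm_sq_eq_trace, Matrix.transpose_mul,
    Matrix.mul_assoc, ← Matrix.mul_assoc Uᵀ, hU, Matrix.one_mul]

lemma frobenius_norm_mul_right {U : Matrix (Fin n) (Fin n) ℝ} (hU : U * Uᵀ = 1)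
    (M : Matrix (Fin n) (Fin n) ℝ) : ‖M * U‖ = ‖M‖ := by
  rw [← Matrix.frobenius_norm_transpose, Matrix.transpose_mul,
    frobenius_norm_mul_left (by simpa using hU), Matrix.frobenius_norm_transpose]

lemma norm_offDiag_le (M : Matrix (Fin n) (Fin n) ℝ) : ‖offDiag M‖ ≤ ‖M‖ := by
  refine le_of_sq_le_sq ?_ (norm_nonneg _)
  rw [frobenius_norm_sq, frobenius_norm_sq]
  refine Finset.sum_le_sum fun i _ => Finset.sum_le_sum fun j _ => ?_
  by_cases h : i = j <;> simp [offDiag, h, sq_nonneg]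

lemma offDiag_add (M N : Matrix (Fin n) (Fin n) ℝ) :
    offDiag (M + N) = offDiag M + offDiag N := by
  ext i j
  by_cases h : i = j <;> simp [offDiag, h]

/-- Gives the freedom to compare `Qᵀ * A k * Q` with any convenient diagonal matrix. -/
lemma offDiag_sub_diagonal (M : Matrix (Fin n) (Fin n) ℝ) (v : Fin n → ℝ) :
    offDiag (M - Matrix.diagonal v) = offDiag M := by
  ext i j
  by_cases h : i = j <;> simp [offDiag, h]


/-- Triangle inequality for the off-diagonality measure. -/
lemma sqrt_loss_add_le (A E : Fin d → Matrix (Fin n) (Fin n) ℝ) (Q : Matrix (Fin n) (Fin n) ℝ) :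
    √(loss (fun k => A k + E k) Q) ≤ √(loss A Q) + √(loss E Q) := by
  have hL (B : Fin d → Matrix (Fin n) (Fin n) ℝ) :
      √(loss B Q) = ‖WithLp.toLp 2 fun k => ‖offDiag (Qᵀ * B k * Q)‖‖ := by
    simp [EuclideanSpace.norm_eq, loss]
  refine le_trans ?_ ((norm_add_le _ _).trans_eq (by rw [hL A, hL E]))
  rw [EuclideanSpace.norm_eq, loss]
  refine Real.sqrt_le_sqrt (Finset.sum_le_sum fun k _ => ?_)
  simp only [Matrix.mul_add, Matrix.add_mul, offDiag_add, PiLp.add_apply, Real.norm_eq_abs, sq_abs]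
  gcongr
  exact norm_add_le _ _

lemma sqrt_loss_le {Q : Matrix (Fin n) (Fin n) ℝ} (hQ : Q ∈ Matrix.orthogonalGroup (Fin n) ℝ)
    (E : Fin d → Matrix (Fin n) (Fin n) ℝ) : √(loss E Q) ≤ √(∑ k, ‖E k‖ ^ 2) := by
  refine Real.sqrt_le_sqrt (Finset.sum_le_sum fun k _ => ?_)
  gcongr
  refine (norm_offDiag_le _).trans_eq ?_
  have h1 : Q * Qᵀ = 1 := (Matrix.mem_orthogonalGroup_iff (Fin n) ℝ).1 hQ
  rw [frobenius_norm_mul_right h1, frobenius_norm_mul_left (by simpa using h1)]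

lemma norm_linComb_le (E : Fin d → Matrix (Fin n) (Fin n) ℝ) (μ : EuclideanSpace ℝ (Fin d)) :
    ‖linComb E μ‖ ≤ ‖μ‖ * √(∑ k, ‖E k‖ ^ 2) := by
  let _ := Matrix.frobeniusNormedSpace (R := ℝ) (α := ℝ) (m := Fin n) (n := Fin n)
  calc ‖linComb E μ‖ ≤ ∑ k, |μ k| * ‖E k‖ :=
        (norm_sum_le _ _).trans_eq (Finset.sum_congr rfl fun k _ => norm_smul _ _)
    _ ≤ √(∑ k, |μ k| ^ 2) * √(∑ k, ‖E k‖ ^ 2) := Real.sum_mul_le_sqrt_mul_sqrt _ _ _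
    _ = _ := by simp [EuclideanSpace.norm_eq]

lemma linComb_add (A E : Fin d → Matrix (Fin n) (Fin n) ℝ) (μ : EuclideanSpace ℝ (Fin d)) :
    linComb (fun k => A k + E k) μ = linComb A μ + linComb E μ := by
  simp [linComb, Finset.sum_add_distrib]

open scoped Function in
/-- A commuting family of symmetric matrices is orthogonally diagonalized by one matrix, and the
columns of the diagonal factors are eigenvalue vectors of the family. -/
lemma exists_orthogonal_simultaneous_diagonalization (A : Fin d → Matrix (Fin n) (Fin n) ℝ)
    (hA : ∀ k, (A k).IsSymm) (hcomm : ∀ k l, Commute (A k) (A l)) :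
    ∃ (V : Matrix (Fin n) (Fin n) ℝ) (Λ : Fin n → EuclideanSpace ℝ (Fin d)),
      Vᵀ * V = 1 ∧ (∀ p, Λ p ∈ eigenvalueVectors A) ∧
        ∀ k, A k * V = V * Matrix.diagonal fun p => Λ p k := by
  classical
  let T : Fin d → Module.End ℝ (EuclideanSpace ℝ (Fin n)) := fun k => Matrix.toEuclideanLin (A k)
  have hT : ∀ k, (T k).IsSymmetric := fun k =>
    Matrix.isSymmetric_toEuclideanLin_iff.2 (by
      rw [Matrix.IsHermitian, Matrix.conjTranspose_eq_transpose_of_trivial]; exact hA k)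
  have hTapp (k) (x : EuclideanSpace ℝ (Fin n)) : (T k x).ofLp = A k *ᵥ x.ofLp := by
    simp [T, Matrix.toLpLin_apply]
  have hC : Pairwise (Commute on T) := by
    intro k l _
    refine LinearMap.ext fun x => (WithLp.ofLp_injective 2) ?_
    simp only [Module.End.mul_apply, hTapp, Matrix.mulVec_mulVec]
    rw [(hcomm k l).eq]
  have hI := LinearMap.IsSymmetric.directSum_isInternal_of_pairwise_commute hT hC
  have hO := LinearMap.IsSymmetric.orthogonalFamily_iInf_eigenspaces hT
  -- Joint eigenspaces are indexed by all of `Fin d → ℝ`; discarding the zero ones leaves the finite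
  -- index type that an adapted orthonormal basis requires.
  let N : (Fin d → ℝ) → Submodule ℝ (EuclideanSpace ℝ (Fin n)) :=
    fun α => ⨅ j, Module.End.eigenspace (T j) (α j)
  have hI' : DirectSum.IsInternal fun i : {α // N α ≠ ⊥} => N i :=
    DirectSum.isInternal_ne_bot_iff.2 hI
  have hO' := hO.comp (f := fun i : {α // N α ≠ ⊥} => i.1) Subtype.val_injective
  have : Fintype {α // N α ≠ ⊥} :=
    (WellFoundedGT.finite_ne_bot_of_iSupIndep hI.submodule_iSupIndep).fintype
  let b := hI'.subordinateOrthonormalBasis (n := n) (by simp) hO'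
  let a : Fin n → {α // N α ≠ ⊥} := fun p => hI'.subordinateOrthonormalBasisIndex (by simp) p hO'
  have hb (p : Fin n) (k : Fin d) : A k *ᵥ (b p).ofLp = (a p).1 k • (b p).ofLp := by
    have h : b p ∈ N (a p) := hI'.subordinateOrthonormalBasis_subordinate (by simp) p hO'
    have h' := Module.End.mem_eigenspace_iff.1 ((Submodule.mem_iInf _).1 h k)
    rw [← hTapp, h']; rfl
  refine ⟨Matrix.of fun i p => b p i, fun p => WithLp.toLp 2 (a p).1, ?_, fun p => ?_, fun k => ?_⟩
  · ext p q
    have h := orthonormal_iff_ite.1 b.orthonormal p q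
    rw [PiLp.inner_apply] at h
    simpa [Matrix.mul_apply, Matrix.one_apply, mul_comm] using h
  · refine ⟨(b p).ofLp, fun h => b.orthonormal.ne_zero p (WithLp.ofLp_injective 2 h), hb p⟩
  · ext i p
    have h := congrFun (hb p k) i
    rw [Matrix.mul_diagonal]
    simpa [Matrix.mul_apply, Matrix.mulVec, dotProduct, mul_comm] using h

/-- If `μ` is not too close to being orthogonal to a difference of two eigenvalue vectors of the
commuting family `A`, then an orthogonal matrix diagonalizing the perturbed linear combination
nearly diagonalizes the family. -/
lemma loss_le_of_separated (A E : Fin d → Matrix (Fin n) (Fin n) ℝ)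
    (hA : ∀ k, (A k).IsSymm) (hcomm : ∀ k l, Commute (A k) (A l))
    (ε γ : ℝ) (hγ : 0 < γ) (hEε : √(∑ k, ‖E k‖ ^ 2) ≤ ε)
    (μ : EuclideanSpace ℝ (Fin d)) (Q : Matrix (Fin n) (Fin n) ℝ)
    (hQ : Diagonalizes Q (linComb (fun k => A k + E k) μ))
    (hgap : ∀ Λ ∈ eigenvalueVectors A, ∀ Λ' ∈ eigenvalueVectors A, Λ ≠ Λ' →
      4 * ε ≤ γ * ‖Λ - Λ'‖)
    (hsep : ∀ Λ ∈ eigenvalueVectors A, ∀ Λ' ∈ eigenvalueVectors A, Λ ≠ Λ' →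
      3 / 4 * γ * ‖μ‖ * ‖Λ - Λ'‖ < |⟪μ, Λ - Λ'⟫|) :
    √(loss A Q) ≤ 2 * ε / γ := by
  obtain ⟨V, Λ, hV, hΛ, hAV⟩ := exists_orthogonal_simultaneous_diagonalization A hA hcomm
  have hε : 0 ≤ ε := (Real.sqrt_nonneg _).trans hEε
  have hV' : V * Vᵀ = 1 := mul_eq_one_comm.1 hV
  obtain ⟨hQo, hQd⟩ := hQ
  have hQ' : Q * Qᵀ = 1 := (Matrix.mem_orthogonalGroup_iff (Fin n) ℝ).1 hQo
  have hQ : Qᵀ * Q = 1 := mul_eq_one_comm.1 hQ'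
  set W := Vᵀ * Q with hW
  have hWW : Wᵀ * W = 1 := by
    rw [hW, Matrix.transpose_mul, Matrix.transpose_transpose, Matrix.mul_assoc,
      ← Matrix.mul_assoc V, hV', Matrix.one_mul, hQ]
  have hWW' : W * Wᵀ = 1 := mul_eq_one_comm.1 hWW
  have hVA (k) : Vᵀ * A k = (Matrix.diagonal fun p => Λ p k) * Vᵀ := by
    calc Vᵀ * A k = Vᵀ * (A k * V) * Vᵀ := by
          rw [Matrix.mul_assoc, Matrix.mul_assoc, hV', Matrix.mul_one]
      _ = _ := by rw [hAV, ← Matrix.mul_assoc Vᵀ, hV, Matrix.one_mul]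
  -- eigenvalues of the unperturbed and of the perturbed linear combination
  set α : Fin n → ℝ := fun p => ⟪μ, Λ p⟫ with hα
  have hVAμ : Vᵀ * linComb A μ = Matrix.diagonal α * Vᵀ := by
    have : Matrix.diagonal α = ∑ k, μ k • Matrix.diagonal fun p => Λ p k := by
      ext p q
      by_cases h : p = q
      · subst h
        simp [hα, PiLp.inner_apply, Matrix.sum_apply, mul_comm]
      · simp [h, Matrix.sum_apply]
    rw [this, linComb, Matrix.mul_sum, Matrix.sum_mul]
    refine Finset.sum_congr rfl fun k _ => ?_
    rw [Matrix.mul_smul, Matrix.smul_mul, hVA]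
  obtain ⟨δ, hδ⟩ : ∃ δ : Fin n → ℝ,
      Qᵀ * linComb (fun k => A k + E k) μ * Q = Matrix.diagonal δ :=
    ⟨_, hQd.diagonal_diag.symm⟩
  have hMQ : linComb (fun k => A k + E k) μ * Q = Q * Matrix.diagonal δ := by
    rw [← hδ, ← Matrix.mul_assoc, ← Matrix.mul_assoc, hQ', Matrix.one_mul]
  have hF : Vᵀ * linComb E μ * Q = W * Matrix.diagonal δ - Matrix.diagonal α * W := by
    have : linComb E μ = linComb (fun k => A k + E k) μ - linComb A μ := by
      rw [linComb_add, add_sub_cancel_left]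
    rw [this, Matrix.mul_sub, Matrix.sub_mul, Matrix.mul_assoc Vᵀ, hMQ, hVAμ, hW]
    simp only [Matrix.mul_assoc]
  have hFentry (p i) : (Vᵀ * linComb E μ * Q) p i = W p i * (δ i - α p) := by
    rw [hF, Matrix.sub_apply, Matrix.mul_diagonal, Matrix.diagonal_mul]; ring
  have hFnorm : ∑ p, ∑ i, (W p i * (δ i - α p)) ^ 2 ≤ (ε * ‖μ‖) ^ 2 := by
    simp only [← hFentry]
    rw [← frobenius_norm_sq, frobenius_norm_mul_right hQ', frobenius_norm_mul_left (by simpa)]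
    refine pow_le_pow_left₀ (norm_nonneg _) ((norm_linComb_le E μ).trans ?_) 2
    rw [mul_comm]; gcongr
  -- every perturbed eigenvalue is close to an unperturbed one
  have hclose (i : Fin n) : ∃ c, |δ i - α c| ≤ ε * ‖μ‖ := by
    by_contra! hcon
    -- The squares in column `i` of `W` are weights summing to `1`, so the weighted mean of `(δ i -
    -- α p) ^ 2` would exceed `(ε * ‖μ‖) ^ 2`.
    have hcol : ∑ p, W p i ^ 2 = 1 := by
      have := congrFun (congrFun hWW i) i
      simpa [Matrix.mul_apply, sq] using this
    have h1 : ∑ p, (W p i * (δ i - α p)) ^ 2 ≤ (ε * ‖μ‖) ^ 2 := by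
      refine le_trans (Finset.sum_le_sum fun p _ => ?_) hFnorm
      exact Finset.single_le_sum (f := fun i => (W p i * (δ i - α p)) ^ 2)
        (fun _ _ => sq_nonneg _) (Finset.mem_univ i)
    have h2 : (ε * ‖μ‖) ^ 2 < ∑ p, (W p i * (δ i - α p)) ^ 2 := by
      have hsq (p) : (ε * ‖μ‖) ^ 2 < (δ i - α p) ^ 2 := by
        rw [← sq_abs (δ i - α p)]
        exact pow_lt_pow_left₀ (hcon p) (by positivity) two_ne_zero
      obtain ⟨p, hp⟩ : ∃ p, W p i ≠ 0 := by
        by_contra! h0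
        simp [h0] at hcol
      calc (ε * ‖μ‖) ^ 2 = ∑ p, W p i ^ 2 * (ε * ‖μ‖) ^ 2 := by
            rw [← Finset.sum_mul, hcol, one_mul]
        _ < _ := by
            refine Finset.sum_lt_sum (fun q _ => ?_) ⟨p, Finset.mem_univ p, ?_⟩
            · rw [mul_pow (W _ i)]
              exact mul_le_mul_of_nonneg_left (hsq q).le (sq_nonneg _)
            · rw [mul_pow (W _ i)]
              exact mul_lt_mul_of_pos_left (hsq p) (by positivity)
    exact absurd h1 (not_le.2 h2)
  choose c hc using hclose
  -- the deviation of the columns of `Q` from the invariant subspaces of the family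
  have hloss : loss A Q ≤ ∑ p, ∑ i, W p i ^ 2 * ‖Λ p - Λ (c i)‖ ^ 2 := by
    have hk (k : Fin d) : ‖offDiag (Qᵀ * A k * Q)‖ ^ 2 ≤
        ∑ p, ∑ i, W p i ^ 2 * (Λ p k - Λ (c i) k) ^ 2 := by
      -- `Wᵀ * G` differs from `Qᵀ * A k * Q` by a diagonal matrix, while the entries of `G` are
      -- explicit.
      set G := (Matrix.diagonal fun p => Λ p k) * W - W * Matrix.diagonal fun i => Λ (c i) k
        with hG
      have hQA : Qᵀ * A k * Q = Wᵀ * ((Matrix.diagonal fun p => Λ p k) * W) := by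
        have : Qᵀ = Wᵀ * Vᵀ := by
          rw [hW, Matrix.transpose_mul, Matrix.transpose_transpose, Matrix.mul_assoc, hV',
            Matrix.mul_one]
        rw [this, Matrix.mul_assoc Wᵀ, hVA, hW]
        simp only [Matrix.mul_assoc]
      have hWG : Wᵀ * G = Qᵀ * A k * Q - Matrix.diagonal fun i => Λ (c i) k := by
        rw [hG, Matrix.mul_sub, hQA, ← Matrix.mul_assoc Wᵀ W, hWW, Matrix.one_mul]
      calc ‖offDiag (Qᵀ * A k * Q)‖ ^ 2 = ‖offDiag (Wᵀ * G)‖ ^ 2 := by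
            rw [hWG, offDiag_sub_diagonal]
        _ ≤ ‖G‖ ^ 2 := by
            gcongr
            exact (norm_offDiag_le _).trans_eq (frobenius_norm_mul_left (by simpa) _)
        _ = _ := by
            rw [frobenius_norm_sq]
            refine Finset.sum_congr rfl fun p _ => Finset.sum_congr rfl fun i _ => ?_
            rw [hG, Matrix.sub_apply, Matrix.mul_diagonal, Matrix.diagonal_mul]; ring
    refine (Finset.sum_le_sum fun k _ => hk k).trans_eq ?_
    rw [Finset.sum_comm]
    refine Finset.sum_congr rfl fun p _ => ?_
    rw [Finset.sum_comm]
    refine Finset.sum_congr rfl fun i _ => ?_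
    rw [← Finset.mul_sum, EuclideanSpace.real_norm_sq_eq]
    simp
  -- The separation gives `3 / 4`; moving from `α (c i)` to `δ i` loses `ε * ‖μ‖`, at most `1 / 4`
  -- by `hgap`. This leaves `γ / 2`.
  have hcontract (p i) : (γ / 2 * ‖μ‖ * ‖Λ p - Λ (c i)‖) ^ 2 ≤ (δ i - α p) ^ 2 := by
    rw [← sq_abs (δ i - α p)]
    refine pow_le_pow_left₀ (by positivity) ?_ 2
    rcases eq_or_ne (Λ p) (Λ (c i)) with h | h
    · simp [h]
    have h1 := hsep _ (hΛ p) _ (hΛ (c i)) h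
    have h2 := mul_le_mul_of_nonneg_right (hgap _ (hΛ p) _ (hΛ (c i)) h) (norm_nonneg μ)
    rw [inner_sub_right] at h1
    have h3 : |α p - α (c i)| ≤ |δ i - α p| + |δ i - α (c i)| := by
      have := abs_sub (δ i - α (c i)) (δ i - α p)
      rw [show δ i - α (c i) - (δ i - α p) = α p - α (c i) by ring] at this
      linarith
    have h4 := hc i
    simp only [hα] at h3 h4 ⊢
    linarith
  refine Real.sqrt_le_iff.2 ⟨by positivity, hloss.trans ?_⟩
  -- For `μ = 0` the strict inequality in `hsep` rules out distinct eigenvalue vectors among the `Λ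
  -- p`.
  rcases eq_or_ne μ 0 with rfl | hμ
  · have hzero (p q) : Λ p = Λ q := by
      by_contra h
      simpa using hsep _ (hΛ p) _ (hΛ q) h
    have : ∑ p, ∑ i, W p i ^ 2 * ‖Λ p - Λ (c i)‖ ^ 2 = 0 :=
      Finset.sum_eq_zero fun p _ => Finset.sum_eq_zero fun i _ => by simp [hzero p (c i)]
    rw [this]; positivity
  have hμ' : 0 < ‖μ‖ := norm_pos_iff.2 hμ
  have hkey : (γ / 2 * ‖μ‖) ^ 2 * ∑ p, ∑ i, W p i ^ 2 * ‖Λ p - Λ (c i)‖ ^ 2 ≤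
      (ε * ‖μ‖) ^ 2 := by
    refine le_trans ?_ hFnorm
    rw [Finset.mul_sum]
    refine Finset.sum_le_sum fun p _ => ?_
    rw [Finset.mul_sum]
    refine Finset.sum_le_sum fun i _ => ?_
    have := mul_le_mul_of_nonneg_left (hcontract p i) (sq_nonneg (W p i))
    rw [mul_pow (W p i)]
    calc _ = W p i ^ 2 * (γ / 2 * ‖μ‖ * ‖Λ p - Λ (c i)‖) ^ 2 := by ring
      _ ≤ _ := this
  rw [← le_div_iff₀' (by positivity)] at hkey
  refine hkey.trans_eq ?_
  field_simp

end Perturbation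

/-! ### Union bound over pairs -/

lemma card_filter_lt_eq (m : ℕ) :
    (((Finset.univ.filter fun p : Fin m × Fin m => p.1 < p.2).card : ℕ) : ℝ) =
      (m : ℝ) * (m - 1) / 2 := by
  have h : (Finset.univ.filter fun p : Fin m × Fin m => p.1 < p.2).card =
      ∑ i ∈ Finset.range m, i := by
    rw [Finset.card_filter, Fintype.sum_prod_type_right, ← Fin.sum_univ_eq_sum_range (fun i => i)]
    refine Finset.sum_congr rfl fun j _ => ?_
    rw [← Finset.card_filter, Finset.filter_gt_eq_Iio, Fin.card_Iio]
  rw [h, eq_div_iff two_ne_zero]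
  have h2 := Finset.sum_range_id_mul_two m
  rcases m with _ | m
  · simp
  · have h3 : (((∑ i ∈ Finset.range (m + 1), i) * 2 : ℕ) : ℝ) = ((m + 1) * m : ℕ) := by
      rw [h2]; simp
    push_cast at h3 ⊢
    rw [h3]; ring

/-- Union bound over the unordered pairs of a finite set of vectors. -/
lemma stdGaussian_real_exists_abs_inner_sub_le {d : ℕ} (hd : 1 ≤ d)
    {S : Set (EuclideanSpace ℝ (Fin d))} (hS : S.Finite) (γ : ℝ) (hγ : 0 ≤ γ) :
    (stdGaussian (EuclideanSpace ℝ (Fin d))).real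
        {x | ∃ a ∈ S, ∃ b ∈ S, a ≠ b ∧ |⟪x, a - b⟫| ≤ 3 / 4 * γ * ‖x‖ * ‖a - b‖} ≤
      √(d / (2 * Real.pi)) * (S.ncard * (S.ncard - 1)) * γ := by
  have : Finite S := hS
  obtain ⟨e⟩ : Nonempty (Fin S.ncard ≃ S) := ⟨(Finite.equivFin S).symm⟩
  set I := Finset.univ.filter fun p : Fin S.ncard × Fin S.ncard => p.1 < p.2 with hI
  let B : Fin S.ncard × Fin S.ncard → Set (EuclideanSpace ℝ (Fin d)) := fun p =>
    {x | |⟪x, (e p.1 : EuclideanSpace ℝ (Fin d)) - e p.2⟫| ≤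
      3 / 4 * γ * ‖x‖ * ‖(e p.1 : EuclideanSpace ℝ (Fin d)) - e p.2‖}
  have hsub : {x : EuclideanSpace ℝ (Fin d) | ∃ a ∈ S, ∃ b ∈ S, a ≠ b ∧
      |⟪x, a - b⟫| ≤ 3 / 4 * γ * ‖x‖ * ‖a - b‖} ⊆ ⋃ p ∈ I, B p := by
    rintro x ⟨a, ha, b, hb, hab, hx⟩
    obtain ⟨i, hi⟩ := e.surjective ⟨a, ha⟩
    obtain ⟨j, hj⟩ := e.surjective ⟨b, hb⟩
    have hij : i ≠ j := by
      rintro rfl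
      exact hab (congrArg Subtype.val (hi.symm.trans hj))
    simp only [Set.mem_iUnion]
    rcases lt_or_gt_of_ne hij with h | h
    · exact ⟨(i, j), by simpa [hI] using h, by simpa [B, hi, hj] using hx⟩
    · refine ⟨(j, i), by simpa [hI] using h, ?_⟩
      rw [← abs_neg, ← inner_neg_right, neg_sub, norm_sub_rev] at hx
      simpa [B, hi, hj] using hx
  -- This factor `2` cancels the `1 / 2` in the number of unordered pairs.
  have hsqrt : √(2 * d / Real.pi) = 2 * √(d / (2 * Real.pi)) := by
    rw [show (2 * d / Real.pi : ℝ) = 2 ^ 2 * (d / (2 * Real.pi)) by field_simp,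
      Real.sqrt_mul (by positivity), Real.sqrt_sq zero_le_two]
  calc _ ≤ (stdGaussian (EuclideanSpace ℝ (Fin d))).real (⋃ p ∈ I, B p) :=
        measureReal_mono hsub (measure_ne_top _ _)
    _ ≤ ∑ p ∈ I, (stdGaussian (EuclideanSpace ℝ (Fin d))).real (B p) :=
        measureReal_biUnion_finset_le _ _
    _ ≤ ∑ p ∈ I, √(2 * d / Real.pi) * γ := by
        refine Finset.sum_le_sum fun p hp => stdGaussian_real_abs_inner_le hd _ ?_ γ hγ
        rw [sub_ne_zero]
        exact fun h => (Finset.mem_filter.1 hp).2.ne (e.injective (Subtype.ext h))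
    _ = _ := by
        rw [Finset.sum_const, nsmul_eq_mul, card_filter_lt_eq, hsqrt]; ring

/-- Needed to transfer the bad event through the law of `μ`; the failure event itself need not be
measurable. -/
lemma measurableSet_exists_abs_inner_sub_le {d : ℕ} {S : Set (EuclideanSpace ℝ (Fin d))}
    (hS : S.Finite) (γ : ℝ) :
    MeasurableSet {x | ∃ a ∈ S, ∃ b ∈ S, a ≠ b ∧ |⟪x, a - b⟫| ≤ γ * ‖x‖ * ‖a - b‖} := by
  have h : {x | ∃ a ∈ S, ∃ b ∈ S, a ≠ b ∧ |⟪x, a - b⟫| ≤ γ * ‖x‖ * ‖a - b‖} =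
      ⋃ a ∈ S, ⋃ b ∈ S, {x | a ≠ b ∧ |⟪x, a - b⟫| ≤ γ * ‖x‖ * ‖a - b‖} := by
    ext x
    simp only [Set.mem_iUnion, exists_prop, Set.mem_ofPred_eq]
  rw [h]
  refine hS.measurableSet_biUnion fun a _ => hS.measurableSet_biUnion fun b _ => ?_
  have hle : MeasurableSet {x : EuclideanSpace ℝ (Fin d) | |⟪x, a - b⟫| ≤ γ * ‖x‖ * ‖a - b‖} :=
    measurableSet_le (by fun_prop) (by fun_prop)
  exact (MeasurableSet.const (a ≠ b)).inter hle

/-! ### Failure probability and conclusion -/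

lemma gap_le_norm_sub {n d : ℕ} (A : Fin d → Matrix (Fin n) (Fin n) ℝ)
    {a b : EuclideanSpace ℝ (Fin d)} (ha : a ∈ eigenvalueVectors A) (hb : b ∈ eigenvalueVectors A)
    (hab : a ≠ b) : 0 < gap A ∧ gap A ≤ ‖a - b‖ := by
  have hm : 2 ≤ numEigenvalueVectors A :=
    (Set.one_lt_ncard_iff (finite_eigenvalueVectors A)).2 ⟨a, b, ha, hb, hab⟩
  obtain ⟨h1, h2⟩ := gap_isLeast A hm
  exact ⟨h2, h1.2 ⟨a, ha, b, hb, hab, rfl⟩⟩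

/-- Failure of one trial of randomized joint diagonalization has small outer probability. -/
lemma measureReal_not_sqrt_loss_le {Ω : Type*} [MeasurableSpace Ω] (P : Measure Ω)
    [IsProbabilityMeasure P] {n d : ℕ} (A E : Fin d → Matrix (Fin n) (Fin n) ℝ)
    (hA : ∀ k, (A k).IsSymm) (hcomm : ∀ k l, Commute (A k) (A l))
    (ε R : ℝ) (hε : 0 < ε) (hR : 1 < R) (hEε : √(∑ k, ‖E k‖ ^ 2) ≤ ε)
    (μ : Ω → Fin 1 → EuclideanSpace ℝ (Fin d)) (Q : Ω → Matrix (Fin n) (Fin n) ℝ)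
    (hQ : IsRun P 1 (fun k => A k + E k) μ Q)
    (γ : ℝ) (hγ : γ = max (√(5 * d) / (R - 1)) (4 * ε / gap A)) :
    P.real {ω | ¬ √(loss (fun k => A k + E k) (Q ω)) ≤ R * ε} ≤
      √(d / (2 * Real.pi)) * (numEigenvalueVectors A * (numEigenvalueVectors A - 1)) * γ := by
  have hR1 : 0 < R - 1 := sub_pos.2 hR
  rcases Nat.eq_zero_or_pos d with rfl | hd
  · have : {ω | ¬ √(loss (fun k => A k + E k) (Q ω)) ≤ R * ε} = ∅ := by
      ext ω
      simp only [loss, Finset.univ_eq_empty, Finset.sum_empty, Real.sqrt_zero, Set.mem_ofPred_eq,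
        Set.mem_empty_iff_false, iff_false, not_not]
      positivity
    rw [this]; simp
  have hd' : (1 : ℝ) ≤ d := by exact_mod_cast hd
  -- Positivity comes from the first term: with fewer than two eigenvalue vectors, `gap A = sInf ∅ =
  -- 0` and `4 * ε / gap A = 0`.
  have hγ0 : 0 < γ := by
    rw [hγ]
    exact lt_max_of_lt_left (by positivity)
  -- Only `√(5 * d) ≥ 2` is needed here.
  have hγR : 2 / γ ≤ R - 1 := by
    rw [div_le_comm₀ hγ0 hR1]
    refine le_trans ?_ (hγ.symm ▸ le_max_left _ _)
    gcongr
    exact Real.le_sqrt_of_sq_le (by linarith)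
  have hgap : ∀ a ∈ eigenvalueVectors A, ∀ b ∈ eigenvalueVectors A, a ≠ b →
      4 * ε ≤ γ * ‖a - b‖ := by
    intro a ha b hb hab
    obtain ⟨h1, h2⟩ := gap_le_norm_sub A ha hb hab
    have h3 : 4 * ε / gap A ≤ γ := hγ.symm ▸ le_max_right _ _
    exact ((div_le_iff₀ h1).1 h3).trans (mul_le_mul_of_nonneg_left h2 hγ0.le)
  set B := {x | ∃ a ∈ eigenvalueVectors A, ∃ b ∈ eigenvalueVectors A, a ≠ b ∧
    |⟪x, a - b⟫| ≤ 3 / 4 * γ * ‖x‖ * ‖a - b‖} with hB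
  have hBm : MeasurableSet B := measurableSet_exists_abs_inner_sub_le
    (finite_eigenvalueVectors A) _
  have hlaw : HasLaw (fun ω => μ ω 0) (stdGaussian (EuclideanSpace ℝ (Fin d))) P :=
    (measurePreserving_eval (fun _ : Fin 1 => stdGaussian (EuclideanSpace ℝ (Fin d)))
      0).hasLaw.comp hQ.law
  have hfail : {ω | ¬ √(loss (fun k => A k + E k) (Q ω)) ≤ R * ε} ≤ᵐ[P] {ω | μ ω 0 ∈ B} := by
    filter_upwards [hQ.output] with ω hω
    refine not_imp_comm.1 fun hnB => ?_
    obtain ⟨T, hT, i, -, hQT⟩ := hω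
    have hdiag : Diagonalizes (Q ω) (linComb (fun k => A k + E k) (μ ω 0)) := by
      rw [hQT, Subsingleton.elim i 0]; exact hT 0
    have hsep := loss_le_of_separated A E hA hcomm ε γ hγ0 hEε (μ ω 0) (Q ω) hdiag hgap
      fun a ha b hb hab => not_le.1 fun h => hnB ⟨a, ha, b, hb, hab, h⟩
    have h2 : 2 * ε / γ ≤ (R - 1) * ε := by
      rw [mul_div_right_comm]; gcongr
    have h3 := sqrt_loss_add_le A E (Q ω)
    have h4 := (sqrt_loss_le hdiag.1 E).trans hEε
    change √(loss (fun k => A k + E k) (Q ω)) ≤ R * ε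
    linarith
  calc _ ≤ P.real {ω | μ ω 0 ∈ B} :=
        ENNReal.toReal_mono (measure_ne_top _ _) (measure_mono_ae hfail)
    _ = (stdGaussian (EuclideanSpace ℝ (Fin d))).real B := hlaw.measureReal_eq hBm
    _ ≤ _ := stdGaussian_real_exists_abs_inner_sub_le hd (finite_eigenvalueVectors A) γ hγ0.le

end RJD

theorem theorem3p2 {Ω : Type*} [MeasurableSpace Ω] (P : Measure Ω) [IsProbabilityMeasure P]
    {n d : ℕ} (A E : Fin d → Matrix (Fin n) (Fin n) ℝ)
    (hA : ∀ k, (A k).IsSymm) (hcomm : ∀ k l, Commute (A k) (A l))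
    (hE : ∀ k, (E k).IsSymm)
    (ε R : ℝ) (hε : 0 < ε) (hR : 1 < R)
    (hEε : √(∑ k, ‖E k‖ ^ 2) ≤ ε)
    (μ : Ω → Fin 1 → EuclideanSpace ℝ (Fin d)) (Q : Ω → Matrix (Fin n) (Fin n) ℝ)
    (hQ : RJD.IsRun P 1 (fun k => A k + E k) μ Q)
    (m γ : ℝ) (hm : m = (RJD.numEigenvalueVectors A : ℝ))
    (hγ : γ = max (√(5 * d) / (R - 1)) (4 * ε / RJD.gap A)) :
    1 - √(d / (2 * Real.pi)) * (m * (m - 1)) * γ ≤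
        P.real {ω | √(RJD.loss (fun k => A k + E k) (Q ω)) ≤ R * ε} ∧
      P.real {ω | ¬ √(RJD.loss (fun k => A k + E k) (Q ω)) ≤ R * ε} ≤
        √(d / (2 * Real.pi)) * (m * (m - 1)) * γ := by
  have h := RJD.measureReal_not_sqrt_loss_le P A E hA hcomm ε R hε hR hEε μ Q hQ γ hγ
  rw [← hm] at h
  refine ⟨?_, h⟩
  -- `Q` need not be measurable, so subadditivity replaces the complement rule.
  have h1 := measureReal_union_le (μ := P)
    {ω | √(RJD.loss (fun k => A k + E k) (Q ω)) ≤ R * ε}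
    {ω | ¬ √(RJD.loss (fun k => A k + E k) (Q ω)) ≤ R * ε}
  have h2 : {ω | √(RJD.loss (fun k => A k + E k) (Q ω)) ≤ R * ε} ∪
      {ω | ¬ √(RJD.loss (fun k => A k + E k) (Q ω)) ≤ R * ε} = Set.univ :=
    Set.union_compl_self _
  rw [h2, probReal_univ] at h1
  linarith
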